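/- **Setting.** Let $\mathcal{X}$ be a measurable space, $\mathcal{Y}=\{1,-1\}$, and let $\mathcal{F}$ be a set of measurable classifiers $f:\mathcal{X}\to\mathcal{Y}$ of VC dimension $d$, $1\le d<\infty$ (the largest cardinality of a finite subset of $\mathcal X$ on which $\mathcal F$ realizes all $\pm1$ labellings). For a probability measure $P$ on $\mathcal{X}\times\mathcal{Y}$ put $R(f)=P(f(X)\ne Y)$ and $\eta(X)=\mathbb{E}[Y\mid X]$; a Bayes classifier is a measurable $f^*$ with $f^*(X)=\operatorname{sign}\eta(X)$ almost surely on $\{\eta(X)\neq 0\}$. For $h\in[0,1]$ let $\mathcal{P}(h,\mathcal{F})$ be the set of all $P$ for which some Bayes classifier belongs to $\mathcal{F}$ and $|\eta(X)|\ge h$ almost surely. Throughout, $\log x$ denotes $\ln(\max(x,e))$. For points $x_1,\dots,x_N\in\mathcal{X}$ (repetitions allowed) let $\rho_H(f,g)=|\{i: f(x_i)\ne g(x_i)\}|$, let $\mathcal{B}_H(f,r)=\{g\in\mathcal{F}:\rho_H(f,g)\le r\}$, and let $\mathcal{M}_1(\mathcal{H},\varepsilon)$ be the largest cardinality of a subset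 of $\mathcal{H}$ whose distinct members are at $\rho_H$-distance $>\varepsilon$. Define $$\mathcal{M}^{\mathrm{loc}}_1(\mathcal{F},\gamma,N,h')=\max_{x_1,\dots,x_N}\ \max_{f\in\mathcal{F}}\ \max_{\varepsilon\ge\gamma}\ \mathcal{M}_1\big(\mathcal{B}_H(f,\varepsilon/h'),\varepsilon/2\big),$$ $$\gamma^{\mathrm{loc}}_{h,h'}(N)=\max\{\gamma\in\mathbb{N}: h\gamma\le\log\mathcal{M}^{\mathrm{loc}}_1(\mathcal{F},\gamma,N,h')\}.$$ For a real $c_{\mathcal F}\ge 1$, the class $\mathcal{F}$ is called $c_{\mathcal{F}}$-pseudoconvex (at the margin $h$) if for every $N\in\mathbb{N}$ the maximum defining $\mathcal{M}^{\mathrm{loc}}_1(\mathcal{F},\gamma^{\mathrm{loc}}_{h,1}(N),N,1)$ is attained at some $x_1,\dots,x_N$, $f\in\mathcal F$ and a radius $\varepsilon\le c_{\mathcal{F}}\,\gamma^{\mathrm{loc}}_{h,1}(N)$. A learning algorithm for samples of size $n$ maps a sample in $(\mathcal{X}\times\mathcal{Y})^n$, and possibly an independent internal random element with an arbitrary law,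 to a measurable classifier $\tilde f:\mathcal{X}\to\mathcal{Y}$, not necessarily in $\mathcal{F}$, such that $\tilde f(x)$ is, for each fixed $x$, a measurable function of the randomness and the sample. **Theorem.** There is a universal constant $C>0$ such that the following holds. Let $\mathcal{F}$ be as above, let $n\ge1$, let $\sqrt{d/n}\le h\le 1$, and let $\mathcal{F}$ be $c_{\mathcal{F}}$-pseudoconvex at the margin $h$. Then for every learning algorithm there is a $P\in\mathcal{P}(h,\mathcal{F})$ such that, if the algorithm is applied to $n$ i.i.d. examples from $P$, the expectation below exists and $$\mathbb{E}\big(R(\tilde f)-R(f^*)\big)\ \ge\ C\left(\frac{d}{nh}+\frac{1}{c_{\mathcal{F}}}\cdot\frac{(1-h)\,\gamma^{\mathrm{loc}}_{h,1}\!\left(\left\lceil \frac{n c_{\mathcal{F}} h}{1-h}\right\rceil\right)}{n}\right),$$ where $f^*$ is any Bayes classifier of $P$ and, for $h=1$, the second summand is read as $0$. -/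

import Mathlib

open MeasureTheory

universe u v

noncomputable section

namespace LocalEntropy

/-! Labels are `ℤˣ = {1, -1}`; a classifier on the instance space `X` is a map `X → ℤˣ`, and
training examples live in `X × ℤˣ` with the product σ-algebra. -/

/-- A label, read as the real number `1` or `-1`. -/
def labelReal (y : ℤˣ) : ℝ := ((y : ℤ) : ℝ)

/-- The truncated logarithm `ln (max x e)`. -/
def tlog (x : ℝ) : ℝ := Real.log (max x (Real.exp 1))

/-! ### Distributions, risk, bounded noise -/

section Distributions

variable {X : Type u} [MeasurableSpace X]

/-- The risk `R(f) = P(f(X) ≠ Y)`. -/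
def risk (P : Measure (X × ℤˣ)) (f : X → ℤˣ) : ℝ := P.real {z | f z.1 ≠ z.2}

/-- The random variable `η(X) = E[Y | X]`, as a function of the pair `(X, Y)`. -/
def regression (P : Measure (X × ℤˣ)) : X × ℤˣ → ℝ :=
  P[fun z => labelReal z.2 | (inferInstance : MeasurableSpace X).comap Prod.fst]

/-- `f` is (a version of) the Bayes classifier `sign (η(x))`: as `f` takes the values `1` and `-1`,
the equation says that `f(X)` is the sign of `η(X)` whenever `η(X) ≠ 0`. -/
def IsBayesClassifier (P : Measure (X × ℤˣ)) (f : X → ℤˣ) : Prop :=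
  Measurable f ∧ ∀ᵐ z ∂P, labelReal (f z.1) * regression P z = |regression P z|

/-- The set `𝒫(h, F)` of the probability distributions that satisfy Massart's bounded noise
condition with margin `h`: a Bayes classifier belongs to `F`, and `|η(X)| ≥ h` almost surely. -/
def massartClass (h : ℝ) (F : Set (X → ℤˣ)) : Set (Measure (X × ℤˣ)) :=
  {P | IsProbabilityMeasure P ∧ (∃ f ∈ F, IsBayesClassifier P f) ∧ ∀ᵐ z ∂P, h ≤ |regression P z|}

/-- A (possibly randomized, possibly improper) learning algorithm for samples of size `n`; the
internal randomness is the point `ω`. Only separate measurability is asked for: every output is a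
measurable classifier, and the prediction at each fixed instance is a measurable function of the
randomness and the sample. -/
structure Learner (X : Type u) [MeasurableSpace X] (Ω : Type v) [MeasurableSpace Ω] (n : ℕ) where
  /-- The classifier produced from the randomness and the sample. -/
  output : Ω → (Fin n → X × ℤˣ) → X → ℤˣ
  measurable_classifier : ∀ ω s, Measurable (output ω s)
  measurable_prediction : ∀ x, Measurable fun p : Ω × (Fin n → X × ℤˣ) => output p.1 p.2 x

/-- The joint law of the internal randomness (with law `ν`) and, independently of it, an i.i.d.
sample of size `n` from `P`. -/
def trainingLaw {Ω : Type v} [MeasurableSpace Ω] (ν : Measure Ω) (P : Measure (X × ℤˣ)) (n : ℕ) :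
    Measure (Ω × (Fin n → X × ℤˣ)) :=
  ν.prod (Measure.pi fun _ : Fin n => P)

end Distributions

/-! ### VC dimension -/

section Combinatorics

variable {X : Type u}

/-- The finite set `S` is shattered by `F`. -/
def Shatters (F : Set (X → ℤˣ)) (S : Finset X) : Prop :=
  ∀ y : X → ℤˣ, ∃ f ∈ F, ∀ x ∈ S, f x = y x

/-- The VC dimension of `F` is (finite and) equal to `d`. -/
def HasVCDim (F : Set (X → ℤˣ)) (d : ℕ) : Prop :=
  IsGreatest {k : ℕ | ∃ S : Finset X, S.card = k ∧ Shatters F S} d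

/-! ### Local empirical packing numbers and their fixed points -/

/-- The Hamming distance `ρ_H` of `f` and `g` on the points `x₁, …, x_N` (repetitions allowed). -/
def rhoH {N : ℕ} (x : Fin N → X) (f g : X → ℤˣ) : ℕ :=
  hammingDist (fun i => f (x i)) (fun i => g (x i))

/-- `T` is an `ε`-packing of `H`: distinct members are at distance larger than `ε`. -/
def IsPacking {N : ℕ} (x : Fin N → X) (H : Set (X → ℤˣ)) (ε : ℝ) (T : Finset (X → ℤˣ)) : Prop :=
  (T : Set (X → ℤˣ)) ⊆ H ∧ (T : Set (X → ℤˣ)).Pairwise fun f g => ε < (rhoH x f g : ℝ)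

/-- `𝓜₁(H, ε)`: the largest cardinality of an `ε`-packing of `H`. -/
def packingNumber {N : ℕ} (x : Fin N → X) (H : Set (X → ℤˣ)) (ε : ℝ) : ℕ :=
  sSup {k : ℕ | ∃ T : Finset (X → ℤˣ), IsPacking x H ε T ∧ T.card = k}

/-- The Hamming ball of the class `F` with centre `f` and radius `r`. -/
def hammingBall {N : ℕ} (x : Fin N → X) (F : Set (X → ℤˣ)) (f : X → ℤˣ) (r : ℝ) :
    Set (X → ℤˣ) :=
  {g | g ∈ F ∧ (rhoH x f g : ℝ) ≤ r}

/-- `𝓜₁^loc(F, γ, N, h)`: the maximum, over `x₁, …, x_N`, over `f ∈ F` and over radii `ε ≥ γ`, of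
the `ε / 2`-packing number of the ball of radius `ε / h` around `f`. -/
def localPacking (F : Set (X → ℤˣ)) (γ : ℝ) (N : ℕ) (h : ℝ) : ℕ :=
  sSup {k : ℕ | ∃ x : Fin N → X, ∃ f ∈ F, ∃ ε : ℝ, γ ≤ ε ∧
    packingNumber x (hammingBall x F f (ε / h)) (ε / 2) = k}

/-- `γ^loc_{h,h'}(N, F)`: the largest natural number `γ` with
`h γ ≤ log 𝓜₁^loc(F, γ, N, h')`, where `log` is truncated. -/
def gammaLoc (h h' : ℝ) (N : ℕ) (F : Set (X → ℤˣ)) : ℕ :=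
  sSup {γ : ℕ | h * (γ : ℝ) ≤ tlog (localPacking F (γ : ℝ) N h')}

/-- `F` is `c`-pseudoconvex at the margin `h`: `c ≥ 1` and for every `N` the maximum that defines
`𝓜₁^loc(F, γ^loc_{h,1}(N), N, 1)` is attained at a radius `ε ≤ c γ^loc_{h,1}(N)`. -/
def IsPseudoconvex (F : Set (X → ℤˣ)) (h c : ℝ) : Prop :=
  1 ≤ c ∧ ∀ N : ℕ, ∃ x : Fin N → X, ∃ f ∈ F, ∃ ε : ℝ,
    (gammaLoc h 1 N F : ℝ) ≤ ε ∧ ε ≤ c * (gammaLoc h 1 N F : ℝ) ∧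
    packingNumber x (hammingBall x F f (ε / 1)) (ε / 2) =
      localPacking F (gammaLoc h 1 N F : ℝ) N 1

/-! The suprema of natural numbers above are maxima of bounded sets. -/

theorem IsPacking.card_le {N : ℕ} {x : Fin N → X} {H : Set (X → ℤˣ)} {ε : ℝ} (hε : 0 ≤ ε)
    {T : Finset (X → ℤˣ)} (hT : IsPacking x H ε T) : T.card ≤ 2 ^ N := by
  classical
  have hinj : Set.InjOn (fun (f : X → ℤˣ) (i : Fin N) => f (x i)) (T : Set (X → ℤˣ)) := by
    intro f hf g hg hfg
    by_contra hne
    have h1 := hT.2 hf hg hne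
    have h2 : rhoH x f g = 0 := hammingDist_eq_zero.mpr hfg
    simp only [h2] at h1
    norm_num at h1
    linarith
  calc T.card = (T.image fun (f : X → ℤˣ) (i : Fin N) => f (x i)).card :=
        (Finset.card_image_of_injOn hinj).symm
    _ ≤ Fintype.card (Fin N → ℤˣ) := Finset.card_le_univ _
    _ = 2 ^ N := by simp

theorem packingNumber_le {N : ℕ} (x : Fin N → X) (H : Set (X → ℤˣ)) {ε : ℝ} (hε : 0 ≤ ε) :
    packingNumber x H ε ≤ 2 ^ N := by
  apply csSup_le'
  rintro k ⟨T, hT, rfl⟩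
  exact hT.card_le hε

theorem localPacking_le (F : Set (X → ℤˣ)) {γ : ℝ} (hγ : 0 ≤ γ) (N : ℕ) (h : ℝ) :
    localPacking F γ N h ≤ 2 ^ N := by
  apply csSup_le'
  rintro k ⟨x, f, -, ε, hε, rfl⟩
  exact packingNumber_le x _ (by linarith)

theorem bddAbove_gammaLoc {h : ℝ} (hh : 0 < h) (h' : ℝ) (N : ℕ) (F : Set (X → ℤˣ)) :
    BddAbove {γ : ℕ | h * (γ : ℝ) ≤ tlog (localPacking F (γ : ℝ) N h')} := by
  refine ⟨⌈tlog ((2 : ℝ) ^ N) / h⌉₊, fun γ hγ => ?_⟩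
  have h1 : (localPacking F (γ : ℝ) N h' : ℝ) ≤ 2 ^ N := by
    exact_mod_cast localPacking_le F (Nat.cast_nonneg γ) N h'
  have h2 : tlog (localPacking F (γ : ℝ) N h' : ℝ) ≤ tlog ((2 : ℝ) ^ N) :=
    Real.log_le_log (lt_max_of_lt_right (Real.exp_pos 1)) (max_le_max_right _ h1)
  have h3 : (γ : ℝ) ≤ tlog ((2 : ℝ) ^ N) / h := by
    rw [le_div_iff₀ hh, mul_comm]
    exact le_trans hγ h2
  exact_mod_cast h3.trans (Nat.le_ceil _)

end Combinatorics

end LocalEntropy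

end

noncomputable section

namespace LocalEntropy

/-! ### Labels -/

/-! The two summands are bounded from below separately, each by a family of hard distributions that
have finite support and constant noise: instances from a fixed list, with fixed weights, labelled by
some `f ∈ F` and flipped with probability `(1 - h) / 2`. Such a law lies in the Massart class, and
the excess risk of a rule is `h` times the mass of the points where it differs from `f`.
`exists_massart_lower_bound` reduces randomized, improper learners to deterministic rules on the
finite sample space, by averaging over the family for each value of the randomness.

For `d / (n h)`, Assouad's method (`exists_lower_bound_of_cube`) runs on shattered points of mass
about `1 / (n h²)`. Flipping one label is then undetectable from `n` examples, as the Hellinger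
affinity shows; unlike the chi-square divergence, the affinity gives a usable bound up to `h = 1`.

For the local entropy term (`exists_lower_bound_of_packing`), the hypotheses are a maximal packing
of a Hamming ball. Pseudoconvexity supplies one whose radius `ε` satisfies `γ ≤ ε ≤ c γ`: the lower
bound makes every wrong decision costly, while the upper bound keeps the chi-square divergence to
one fixed member so small that `n` examples cannot identify one among `exp (h γ)` hypotheses.

In both cases the surplus mass sits on one point where the whole family agrees. A packing loses at
most half of its members to this demand, and the shattered set at most one point when `d ≥ 2`. For
`d = 1` the demand fails only if members of `F` are equal or opposite everywhere, which
pseudoconvexity excludes (`IsPseudoconvex.exists_ne_eq`). -/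

instance : DiscreteMeasurableSpace ℤˣ := by
  have : MeasurableSingletonClass ℤˣ := ⟨fun u => by
    have h : ({u} : Set ℤˣ) = Units.val ⁻¹' {(u : ℤ)} := by
      ext v
      simp [Units.ext_iff]
    rw [h]
    exact ⟨_, measurableSet_singleton _, rfl⟩⟩
  infer_instance

theorem sum_units (g : ℤˣ → ℝ) : ∑ y, g y = g 1 + g (-1) := by
  rw [UnitsInt.univ, Finset.sum_pair (by decide)]

@[simp] theorem labelReal_one : labelReal 1 = 1 := by simp [labelReal]

@[simp] theorem labelReal_neg_one : labelReal (-1) = -1 := by simp [labelReal]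

theorem labelReal_mul_self (y : ℤˣ) : labelReal y * labelReal y = 1 := by
  rcases Int.units_eq_one_or y with rfl | rfl <;> simp

theorem abs_labelReal (y : ℤˣ) : |labelReal y| = 1 := by
  rcases Int.units_eq_one_or y with rfl | rfl <;> simp

theorem labelReal_mul (y z : ℤˣ) : labelReal y * labelReal z = if y = z then 1 else -1 := by
  rcases Int.units_eq_one_or y with rfl | rfl <;> rcases Int.units_eq_one_or z with rfl | rfl <;>
    norm_num

/-! ### Finitely supported measures with prescribed weights -/

section Weighted

variable {J : Type*} [Fintype J] [MeasurableSpace J] [DiscreteMeasurableSpace J]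

/-- The measure on a finite space that gives the point `z` the mass `q z`. -/
def weightedMeasure (q : J → ℝ) : Measure J := ∑ z, ENNReal.ofReal (q z) • Measure.dirac z

theorem weightedMeasure_apply (q : J → ℝ) (s : Set J) :
    weightedMeasure q s = ∑ z, ENNReal.ofReal (q z) * s.indicator 1 z := by
  simp [weightedMeasure, Measure.dirac_apply]

theorem weightedMeasure_real_apply {q : J → ℝ} (hq : ∀ z, 0 ≤ q z) (s : Set J)
    [DecidablePred (· ∈ s)] :
    (weightedMeasure q).real s = ∑ z, q z * if z ∈ s then 1 else 0 := by
  rw [measureReal_def, weightedMeasure_apply, ENNReal.toReal_sum]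
  · refine Finset.sum_congr rfl fun z _ => ?_
    by_cases hz : z ∈ s <;> simp [hz, hq z]
  · intro z _
    by_cases hz : z ∈ s <;> simp [hz]

theorem weightedMeasure_real_singleton {q : J → ℝ} (hq : ∀ z, 0 ≤ q z) (z : J) :
    (weightedMeasure q).real {z} = q z := by
  classical
  simp [weightedMeasure_real_apply hq]

theorem isProbabilityMeasure_weightedMeasure {q : J → ℝ} (hq : ∀ z, 0 ≤ q z) (h1 : ∑ z, q z = 1) :
    IsProbabilityMeasure (weightedMeasure q) := by
  refine ⟨?_⟩
  rw [weightedMeasure_apply]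
  simp only [Set.indicator_univ, Pi.one_apply, mul_one]
  rw [← ENNReal.ofReal_sum_of_nonneg fun z _ => hq z, h1, ENNReal.ofReal_one]

theorem integral_weightedMeasure {q : J → ℝ} (hq : ∀ z, 0 ≤ q z) (h1 : ∑ z, q z = 1) (g : J → ℝ) :
    ∫ z, g z ∂(weightedMeasure q) = ∑ z, q z * g z := by
  have := isProbabilityMeasure_weightedMeasure hq h1
  rw [integral_fintype (Integrable.of_finite)]
  simp [weightedMeasure_real_singleton hq]

theorem integral_pi_weightedMeasure {q : J → ℝ} (hq : ∀ z, 0 ≤ q z) (h1 : ∑ z, q z = 1) {n : ℕ}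
    (g : (Fin n → J) → ℝ) :
    ∫ s, g s ∂(Measure.pi fun _ : Fin n => weightedMeasure q) = ∑ s, (∏ k, q (s k)) * g s := by
  have := isProbabilityMeasure_weightedMeasure hq h1
  rw [integral_fintype (Integrable.of_finite)]
  refine Finset.sum_congr rfl fun s _ => ?_
  rw [measureReal_def, Measure.pi_singleton, ENNReal.toReal_prod, smul_eq_mul]
  congr 1
  exact Finset.prod_congr rfl fun k _ => weightedMeasure_real_singleton hq _

end Weighted

/-! ### Finitely supported distributions with bounded noise -/

section NoisyLaw

variable {X : Type u} {I : Type*}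

/-- The mass of the example `(x i, y)` when the instance `x i` is drawn with probability `w i` and
its label `y` has conditional mean `h * f (x i)`. -/
def noisyWeight (w : I → ℝ) (x : I → X) (h : ℝ) (f : X → ℤˣ) (z : I × ℤˣ) : ℝ :=
  w z.1 * ((1 + h * (labelReal z.2 * labelReal (f (x z.1)))) / 2)

theorem noisyWeight_nonneg {w : I → ℝ} (hw : ∀ i, 0 ≤ w i) (x : I → X) {h : ℝ} (h0 : 0 ≤ h)
    (h1 : h ≤ 1) (f : X → ℤˣ) (z : I × ℤˣ) : 0 ≤ noisyWeight w x h f z := by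
  refine mul_nonneg (hw _) ?_
  rw [labelReal_mul]
  split_ifs <;> linarith

variable [Fintype I]

theorem sum_noisyWeight_mul (w : I → ℝ) (x : I → X) (h : ℝ) (f : X → ℤˣ) (g : I × ℤˣ → ℝ) :
    ∑ z, noisyWeight w x h f z * g z = ∑ i, w i * ((1 + h) / 2 * g (i, f (x i)) +
      (1 - h) / 2 * g (i, -f (x i))) := by
  rw [Fintype.sum_prod_type]
  refine Finset.sum_congr rfl fun i _ => ?_
  rw [sum_units]
  simp only [noisyWeight]
  rcases Int.units_eq_one_or (f (x i)) with hf | hf <;> simp [hf] <;> ring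

theorem sum_noisyWeight {w : I → ℝ} (hw : ∑ i, w i = 1) (x : I → X) (h : ℝ) (f : X → ℤˣ) :
    ∑ z, noisyWeight w x h f z = 1 := by
  have := sum_noisyWeight_mul w x h f 1
  simp only [Pi.one_apply, mul_one] at this
  rw [this]
  refine (Finset.sum_congr rfl fun i _ => ?_).trans hw
  ring

variable [MeasurableSpace X] [MeasurableSpace I] [DiscreteMeasurableSpace I]

/-- The law of an example whose instance is `x i` with probability `w i` and whose label has the
conditional mean `h * f`. -/
def noisyLaw (w : I → ℝ) (x : I → X) (h : ℝ) (f : X → ℤˣ) : Measure (X × ℤˣ) :=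
  (weightedMeasure (noisyWeight w x h f)).map fun z => (x z.1, z.2)

theorem measurable_sampleMap (x : I → X) : Measurable fun z : I × ℤˣ => (x z.1, z.2) :=
  measurable_of_countable _

theorem isProbabilityMeasure_noisyLaw {w : I → ℝ} (hw : ∀ i, 0 ≤ w i) (hw1 : ∑ i, w i = 1)
    (x : I → X) {h : ℝ} (h0 : 0 ≤ h) (h1 : h ≤ 1) (f : X → ℤˣ) :
    IsProbabilityMeasure (noisyLaw w x h f) := by
  have := isProbabilityMeasure_weightedMeasure (noisyWeight_nonneg hw x h0 h1 f)
    (sum_noisyWeight hw1 x h f)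
  exact Measure.isProbabilityMeasure_map (measurable_sampleMap x).aemeasurable

theorem integral_noisyLaw {w : I → ℝ} (hw : ∀ i, 0 ≤ w i) (hw1 : ∑ i, w i = 1)
    (x : I → X) {h : ℝ} (h0 : 0 ≤ h) (h1 : h ≤ 1) (f : X → ℤˣ) {g : X × ℤˣ → ℝ}
    (hg : Measurable g) :
    ∫ z, g z ∂(noisyLaw w x h f) = ∑ i, w i * ((1 + h) / 2 * g (x i, f (x i)) +
      (1 - h) / 2 * g (x i, -f (x i))) := by
  rw [noisyLaw, integral_map (measurable_sampleMap x).aemeasurable hg.aestronglyMeasurable,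
    integral_weightedMeasure (noisyWeight_nonneg hw x h0 h1 f) (sum_noisyWeight hw1 x h f),
    sum_noisyWeight_mul]

theorem measurable_labelReal : Measurable labelReal := measurable_of_countable _

/-- On each atom the mean label is `(1 + h) / 2 - (1 - h) / 2 = h` times `f`. Since this depends on
`i` only through `x i`, repeated points do no harm. -/
theorem regression_noisyLaw {w : I → ℝ} (hw : ∀ i, 0 ≤ w i) (hw1 : ∑ i, w i = 1)
    (x : I → X) {h : ℝ} (h0 : 0 ≤ h) (h1 : h ≤ 1) {f : X → ℤˣ} (hf : Measurable f) :
    regression (noisyLaw w x h f) =ᵐ[noisyLaw w x h f] fun z => h * labelReal (f z.1) := by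
  have := isProbabilityMeasure_noisyLaw hw hw1 x h0 h1 f
  have hη : Measurable fun t : X => h * labelReal (f t) :=
    (measurable_labelReal.comp hf).const_mul h
  have hηz : Measurable fun z : X × ℤˣ => h * labelReal (f z.1) := hη.comp measurable_fst
  have hy : Measurable fun z : X × ℤˣ => labelReal z.2 := measurable_labelReal.comp measurable_snd
  have hηi : Integrable (fun z : X × ℤˣ => h * labelReal (f z.1)) (noisyLaw w x h f) :=
    Integrable.of_bound hηz.aestronglyMeasurable h (ae_of_all _ fun z => by
      rw [Real.norm_eq_abs, abs_mul, abs_labelReal, mul_one, abs_of_nonneg h0])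
  have hyi : Integrable (fun z : X × ℤˣ => labelReal z.2) (noisyLaw w x h f) :=
    Integrable.of_bound hy.aestronglyMeasurable 1 (ae_of_all _ fun z => by
      rw [Real.norm_eq_abs, abs_labelReal])
  refine (ae_eq_condExp_of_forall_setIntegral_eq measurable_fst.comap_le hyi
    (fun s _ _ => hηi.integrableOn) ?_ ?_).symm
  · rintro _ ⟨B, hB, rfl⟩ -
    have hB' : MeasurableSet (Prod.fst ⁻¹' B : Set (X × ℤˣ)) := measurable_fst hB
    rw [← integral_indicator hB', ← integral_indicator hB',
      integral_noisyLaw hw hw1 x h0 h1 f (hηz.indicator hB'),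
      integral_noisyLaw hw hw1 x h0 h1 f (hy.indicator hB')]
    refine Finset.sum_congr rfl fun i _ => ?_
    by_cases hi : x i ∈ B
    · rcases Int.units_eq_one_or (f (x i)) with hfi | hfi <;> simp [Set.indicator, hi, hfi] <;>
        ring_nf <;> simp
    · simp [Set.indicator, hi]
  · exact (hη.comp (comap_measurable Prod.fst)).aestronglyMeasurable

theorem noisyLaw_mem_massartClass {w : I → ℝ} (hw : ∀ i, 0 ≤ w i) (hw1 : ∑ i, w i = 1)
    (x : I → X) {h : ℝ} (h0 : 0 ≤ h) (h1 : h ≤ 1) {F : Set (X → ℤˣ)} {f : X → ℤˣ}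
    (hf : Measurable f) (hfF : f ∈ F) : noisyLaw w x h f ∈ massartClass h F := by
  have hη := regression_noisyLaw hw hw1 x h0 h1 hf
  refine ⟨isProbabilityMeasure_noisyLaw hw hw1 x h0 h1 f, ⟨f, hfF, hf, ?_⟩, ?_⟩
  · filter_upwards [hη] with z hz
    rw [hz, abs_mul, abs_labelReal, abs_of_nonneg h0, mul_left_comm, labelReal_mul_self]
  · filter_upwards [hη] with z hz
    rw [hz, abs_mul, abs_labelReal, abs_of_nonneg h0, mul_one]

/-- As `h > 0`, the regression function vanishes almost nowhere, so the Bayes classifier is almost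
surely unique. -/
theorem IsBayesClassifier.risk_eq_noisyLaw {w : I → ℝ} (hw : ∀ i, 0 ≤ w i) (hw1 : ∑ i, w i = 1)
    (x : I → X) {h : ℝ} (h0 : 0 < h) (h1 : h ≤ 1) {f g : X → ℤˣ} (hf : Measurable f)
    (hg : IsBayesClassifier (noisyLaw w x h f) g) :
    risk (noisyLaw w x h f) g = risk (noisyLaw w x h f) f := by
  have hgf : ∀ᵐ z ∂(noisyLaw w x h f), g z.1 = f z.1 := by
    filter_upwards [regression_noisyLaw hw hw1 x h0.le h1 hf, hg.2] with z hz hgz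
    rw [hz, abs_mul, abs_labelReal, abs_of_nonneg h0.le, mul_left_comm, labelReal_mul] at hgz
    by_contra hne
    rw [if_neg hne] at hgz
    linarith
  refine measureReal_congr ?_
  filter_upwards [hgf] with z hz
  change (g z.1 ≠ z.2) = (f z.1 ≠ z.2)
  rw [hz]

theorem risk_noisyLaw_sub {w : I → ℝ} (hw : ∀ i, 0 ≤ w i) (hw1 : ∑ i, w i = 1)
    (x : I → X) {h : ℝ} (h0 : 0 ≤ h) (h1 : h ≤ 1) {f g : X → ℤˣ} (hf : Measurable f)
    (hg : Measurable g) :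
    risk (noisyLaw w x h f) g - risk (noisyLaw w x h f) f =
      ∑ i, w i * (h * if g (x i) = f (x i) then 0 else 1) := by
  have key : ∀ g : X → ℤˣ, Measurable g → risk (noisyLaw w x h f) g =
      ∑ i, w i * ((1 + h) / 2 * (if g (x i) = f (x i) then 0 else 1) +
        (1 - h) / 2 * (if g (x i) = f (x i) then 1 else 0)) := by
    intro g hg
    have hS : MeasurableSet {z : X × ℤˣ | g z.1 ≠ z.2} :=
      (measurableSet_eq_fun (hg.comp measurable_fst) measurable_snd).compl
    rw [risk, ← integral_indicator_one hS,
      integral_noisyLaw hw hw1 x h0 h1 f (measurable_one.indicator hS)]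
    refine Finset.sum_congr rfl fun i _ => ?_
    rcases Int.units_eq_one_or (f (x i)) with hfi | hfi <;>
      rcases Int.units_eq_one_or (g (x i)) with hgi | hgi <;>
      simp [Set.indicator, hfi, hgi]
  rw [key g hg, key f hf, ← Finset.sum_sub_distrib]
  refine Finset.sum_congr rfl fun i _ => ?_
  by_cases hi : g (x i) = f (x i) <;> simp [hi]
  ring

end NoisyLaw

/-! ### From deterministic decisions on a finite sample space to learning algorithms -/

section Reduction

variable {X : Type u} [MeasurableSpace X] {I : Type*} [Fintype I]

/-- If every deterministic rule has, on average over a finite family of classifiers, an excess risk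
of at least `B`, then every learning algorithm has, for some member of the family, an expected
excess risk of at least `B`. -/
theorem exists_massart_lower_bound [MeasurableSpace I] [DiscreteMeasurableSpace I]
    {w : I → ℝ} (hw : ∀ i, 0 ≤ w i) (hw1 : ∑ i, w i = 1)
    (x : I → X) {h : ℝ} (h0 : 0 < h) (h1 : h ≤ 1) {F : Set (X → ℤˣ)}
    {ι : Type*} [Fintype ι] [Nonempty ι] {f : ι → X → ℤˣ} (hfm : ∀ j, Measurable (f j))
    (hfF : ∀ j, f j ∈ F) {n : ℕ} {B : ℝ}
    (hB : ∀ A : (Fin n → I × ℤˣ) → X → ℤˣ, Fintype.card ι * B ≤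
      ∑ j, ∑ s, (∏ k, noisyWeight w x h (f j) (s k)) *
        ∑ i, w i * (h * if A s (x i) = f j (x i) then 0 else 1))
    {Ω : Type v} [MeasurableSpace Ω] (ν : Measure Ω) [IsProbabilityMeasure ν] (A : Learner X Ω n) :
    ∃ P ∈ massartClass h F, ∀ fstar : X → ℤˣ, IsBayesClassifier P fstar →
      Integrable (fun p => risk P (A.output p.1 p.2) - risk P fstar) (trainingLaw ν P n) ∧
      B ≤ ∫ p, (risk P (A.output p.1 p.2) - risk P fstar) ∂(trainingLaw ν P n) := by
  classical
  -- The excess risk involves only finitely many predictions, so separate measurability of the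
  -- learner suffices.
  let G (j : ι) (p : Ω × (Fin n → X × ℤˣ)) : ℝ :=
    ∑ i, w i * (h * if A.output p.1 p.2 (x i) = f j (x i) then 0 else 1)
  have hG : ∀ j, Measurable (G j) := fun j => by
    refine Finset.measurable_sum _ fun i _ => ((Measurable.ite ?_ measurable_const
      measurable_const).const_mul _).const_mul _
    exact A.measurable_prediction (x i) (MeasurableSet.of_discrete (s := {f j (x i)}))
  have hGb : ∀ j p, ‖G j p‖ ≤ ∑ i, w i * h := fun j p => by
    rw [Real.norm_eq_abs, abs_of_nonneg (Finset.sum_nonneg fun i _ => mul_nonneg (hw i)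
      (mul_nonneg h0.le (by split_ifs <;> simp)))]
    refine Finset.sum_le_sum fun i _ => mul_le_mul_of_nonneg_left ?_ (hw i)
    split_ifs <;> simp [h0.le]
  have hprob : ∀ j, IsProbabilityMeasure (noisyLaw w x h (f j)) := fun j =>
    isProbabilityMeasure_noisyLaw hw hw1 x h0.le h1 _
  have hGint : ∀ j, Integrable (G j) (trainingLaw ν (noisyLaw w x h (f j)) n) := fun j => by
    have : IsProbabilityMeasure (trainingLaw ν (noisyLaw w x h (f j)) n) := by
      unfold trainingLaw
      infer_instance
    exact Integrable.of_bound (hG j).aestronglyMeasurable _ (ae_of_all _ (hGb j))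
  let φ (s : Fin n → I × ℤˣ) (k : Fin n) : X × ℤˣ := (x (s k).1, (s k).2)
  have hφ : Measurable φ := measurable_of_countable _
  let E (j : ι) (ω : Ω) : ℝ := ∑ s, (∏ k, noisyWeight w x h (f j) (s k)) * G j (ω, φ s)
  have hpi : ∀ j, (Measure.pi fun _ : Fin n => noisyLaw w x h (f j)) =
      (Measure.pi fun _ : Fin n => weightedMeasure (noisyWeight w x h (f j))).map φ := fun j => by
    have := hprob j
    have h3 : ∀ i : Fin n, SigmaFinite (Measure.map (fun z : I × ℤˣ => (x z.1, z.2))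
      (weightedMeasure (noisyWeight w x h (f j)))) := fun i => by
        have : IsProbabilityMeasure (Measure.map (fun z : I × ℤˣ => (x z.1, z.2))
          (weightedMeasure (noisyWeight w x h (f j)))) := hprob j
        infer_instance
    exact (Measure.pi_map_pi (hμ := h3) (fun _ => (measurable_sampleMap x).aemeasurable)).symm
  have hGE : ∀ j, Integrable (E j) ν ∧
      ∫ p, G j p ∂(trainingLaw ν (noisyLaw w x h (f j)) n) = ∫ ω, E j ω ∂ν := fun j => by
    have hsec : ∀ ω, ∫ s, G j (ω, s) ∂(Measure.pi fun _ : Fin n => noisyLaw w x h (f j)) =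
        E j ω := fun ω => by
      have hm : Measurable fun s => G j (ω, s) := (hG j).comp measurable_prodMk_left
      rw [hpi, integral_map hφ.aemeasurable hm.aestronglyMeasurable,
        integral_pi_weightedMeasure (noisyWeight_nonneg hw x h0.le h1 _) (sum_noisyWeight hw1 x h _)]
    refine ⟨?_, ?_⟩
    · have := (hGint j).integral_prod_left
      simpa only [hsec] using this
    · have := hprob j
      unfold trainingLaw
      rw [integral_prod _ (hGint j)]
      simp only [hsec]
  -- For fixed `ω` the learner is a deterministic rule, so `hB` bounds the sum over the family
  -- pointwise in `ω`.
  have hsum : ∃ j, B ≤ ∫ ω, E j ω ∂ν := by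
    by_contra! hlt
    have h2 : ∑ j, ∫ ω, E j ω ∂ν < Fintype.card ι * B := by
      refine (Finset.sum_lt_sum_of_nonempty Finset.univ_nonempty fun j _ => hlt j).trans_eq ?_
      simp
    rw [← integral_finsetSum _ fun j _ => (hGE j).1] at h2
    have h3 : (Fintype.card ι * B : ℝ) ≤ ∫ ω, ∑ j, E j ω ∂ν := by
      have := integral_mono (μ := ν) (integrable_const (Fintype.card ι * B : ℝ))
        (integrable_finsetSum _ fun j _ => (hGE j).1)
        (fun ω => hB fun s => A.output ω (φ s))
      simpa using this
    linarith
  obtain ⟨j, hj⟩ := hsum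
  refine ⟨noisyLaw w x h (f j), noisyLaw_mem_massartClass hw hw1 x h0.le h1 (hfm j) (hfF j),
    fun fstar hstar => ?_⟩
  have hrisk : (fun p : Ω × (Fin n → X × ℤˣ) => risk (noisyLaw w x h (f j)) (A.output p.1 p.2) -
      risk (noisyLaw w x h (f j)) fstar) = G j := by
    funext p
    rw [hstar.risk_eq_noisyLaw hw hw1 x h0 h1 (hfm j), risk_noisyLaw_sub hw hw1 x h0.le h1 (hfm j)
      (A.measurable_classifier _ _)]
  rw [hrisk]
  exact ⟨hGint j, by rw [(hGE j).2]; exact hj⟩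

end Reduction

/-! ### Affinity and second moment of product weights -/

section Tests

/-- Le Cam's inequality, with `a` and `b` the square roots of two densities: write `a b = min *
max`, apply Cauchy–Schwarz, and bound the sum of `max²` by 2. Any pair of errors with `α + β ≥ 1`
costs at least the sum of `min²`. -/
theorem half_sq_sum_mul_le {S : Type*} [Fintype S] {a b α β : S → ℝ} (ha : ∀ s, 0 ≤ a s)
    (hb : ∀ s, 0 ≤ b s) (ha1 : ∑ s, a s ^ 2 ≤ 1) (hb1 : ∑ s, b s ^ 2 ≤ 1) (hα : ∀ s, 0 ≤ α s)
    (hβ : ∀ s, 0 ≤ β s) (hαβ : ∀ s, 1 ≤ α s + β s) :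
    (∑ s, a s * b s) ^ 2 / 2 ≤ ∑ s, a s ^ 2 * α s + ∑ s, b s ^ 2 * β s := by
  have h1 : (∑ s, a s * b s) ^ 2 ≤
      (∑ s, min (a s) (b s) ^ 2) * ∑ s, max (a s) (b s) ^ 2 := by
    have := Finset.sum_mul_sq_le_sq_mul_sq Finset.univ (fun s => min (a s) (b s))
      (fun s => max (a s) (b s))
    simpa only [min_mul_max] using this
  have h2 : ∑ s, max (a s) (b s) ^ 2 ≤ 2 := by
    have : ∑ s, max (a s) (b s) ^ 2 ≤ ∑ s, (a s ^ 2 + b s ^ 2) := by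
      refine Finset.sum_le_sum fun s _ => ?_
      rcases max_choice (a s) (b s) with h | h <;> rw [h] <;>
        nlinarith [sq_nonneg (a s), sq_nonneg (b s)]
    rw [Finset.sum_add_distrib] at this
    linarith
  have h3 : ∑ s, min (a s) (b s) ^ 2 ≤ ∑ s, a s ^ 2 * α s + ∑ s, b s ^ 2 * β s := by
    rw [← Finset.sum_add_distrib]
    refine Finset.sum_le_sum fun s _ => ?_
    have hm : 0 ≤ min (a s) (b s) := le_min (ha s) (hb s)
    have hma : min (a s) (b s) ^ 2 ≤ a s ^ 2 := pow_le_pow_left₀ hm (min_le_left _ _) 2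
    have hmb : min (a s) (b s) ^ 2 ≤ b s ^ 2 := pow_le_pow_left₀ hm (min_le_right _ _) 2
    nlinarith [mul_le_mul_of_nonneg_right hma (hα s), mul_le_mul_of_nonneg_right hmb (hβ s),
      mul_le_mul_of_nonneg_left (hαβ s) (sq_nonneg (min (a s) (b s)))]
  have h4 : 0 ≤ ∑ s, min (a s) (b s) ^ 2 := Finset.sum_nonneg fun s _ => sq_nonneg _
  nlinarith [mul_le_mul_of_nonneg_left h2 h4]

variable {X : Type u} {I : Type*} [Fintype I]

theorem sum_prod_noisyWeight {w : I → ℝ} (hw : ∑ i, w i = 1) (x : I → X) (h : ℝ) (f : X → ℤˣ)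
    (n : ℕ) : ∑ s : Fin n → I × ℤˣ, ∏ k, noisyWeight w x h f (s k) = 1 := by
  have := Fintype.sum_pow (ι := I × ℤˣ) (noisyWeight w x h f) n
  rw [← this, sum_noisyWeight hw, one_pow]

/-- A point contributes its full mass where `f` and `g` agree, and `√(1 - h²) ≥ 1 - h²` times its
mass where they differ. -/
theorem one_sub_le_affinity {w : I → ℝ} (hw : ∀ i, 0 ≤ w i) (hw1 : ∑ i, w i = 1) (x : I → X)
    {h : ℝ} (h0 : 0 ≤ h) (h1 : h ≤ 1) (f g : X → ℤˣ) :
    1 - h ^ 2 * ∑ i, w i * (if f (x i) = g (x i) then 0 else 1) ≤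
      ∑ z, √(noisyWeight w x h f z) * √(noisyWeight w x h g z) := by
  have hs : 1 - h ^ 2 ≤ √(1 - h ^ 2) := by
    refine Real.le_sqrt_of_sq_le ?_
    nlinarith [sq_nonneg h, mul_nonneg (sq_nonneg h) (show 0 ≤ 1 - h ^ 2 by nlinarith)]
  have hsum : 1 - h ^ 2 * ∑ i, w i * (if f (x i) = g (x i) then (0 : ℝ) else 1) =
      ∑ i, (w i - h ^ 2 * (w i * (if f (x i) = g (x i) then 0 else 1))) := by
    rw [Finset.sum_sub_distrib, hw1, Finset.mul_sum]
  rw [Fintype.sum_prod_type, hsum]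
  refine Finset.sum_le_sum fun i _ => ?_
  have key : ∀ y : ℤˣ, w i / 2 * (1 + h * (labelReal y * labelReal (f (x i))) -
      h ^ 2 * (if f (x i) = g (x i) then 0 else 1) -
        h * (labelReal y * labelReal (f (x i))) * (if f (x i) = g (x i) then 0 else 1)) ≤
      √(noisyWeight w x h f (i, y)) * √(noisyWeight w x h g (i, y)) := by
    intro y
    by_cases hfg : f (x i) = g (x i)
    · have : noisyWeight w x h g (i, y) = noisyWeight w x h f (i, y) := by
        simp [noisyWeight, hfg]
      rw [this, Real.mul_self_sqrt (noisyWeight_nonneg hw x h0 h1 f _)]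
      simp only [noisyWeight, hfg, if_true]
      linarith
    · have hg : labelReal (g (x i)) = -labelReal (f (x i)) := by
        rcases Int.units_eq_one_or (f (x i)) with hf | hf <;>
          rcases Int.units_eq_one_or (g (x i)) with hg | hg <;> simp_all
      rw [← Real.sqrt_mul (noisyWeight_nonneg hw x h0 h1 f _)]
      have : noisyWeight w x h f (i, y) * noisyWeight w x h g (i, y) =
          (w i / 2) ^ 2 * (1 - h ^ 2) := by
        have e : (labelReal y * labelReal (f (x i))) * (labelReal y * labelReal (f (x i))) = 1 := by
          rw [mul_mul_mul_comm, labelReal_mul_self, labelReal_mul_self, one_mul]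
        simp only [noisyWeight, hg]
        linear_combination (-(w i / 2) ^ 2 * h ^ 2) * e
      rw [this, Real.sqrt_mul (sq_nonneg _), Real.sqrt_sq (by linarith [hw i]), if_neg hfg]
      refine mul_le_mul_of_nonneg_left ?_ (by linarith [hw i])
      linarith
  rw [sum_units]
  refine le_trans (le_of_eq ?_) (add_le_add (key 1) (key (-1)))
  rcases Int.units_eq_one_or (f (x i)) with hf | hf <;> simp [hf] <;> split_ifs <;> ring

/-- Affinity is multiplicative over the sample, and by Bernoulli's inequality the squared `n`-fold
affinity is at least `1/2`. -/
theorem half_affinity_le_error {w : I → ℝ} (hw : ∀ i, 0 ≤ w i) (hw1 : ∑ i, w i = 1) (x : I → X)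
    {h : ℝ} (h0 : 0 ≤ h) (h1 : h ≤ 1) (f g : X → ℤˣ) {n : ℕ}
    (hn : 4 * n * (h ^ 2 * ∑ i, w i * (if f (x i) = g (x i) then 0 else 1)) ≤ 1)
    {α β : (Fin n → I × ℤˣ) → ℝ} (hα : ∀ s, 0 ≤ α s) (hβ : ∀ s, 0 ≤ β s)
    (hαβ : ∀ s, 1 ≤ α s + β s) :
    1 / 4 ≤ ∑ s, (∏ k, noisyWeight w x h f (s k)) * α s +
      ∑ s, (∏ k, noisyWeight w x h g (s k)) * β s := by
  have hsq : ∀ (f : X → ℤˣ) (s : Fin n → I × ℤˣ),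
      (∏ k, √(noisyWeight w x h f (s k))) ^ 2 = ∏ k, noisyWeight w x h f (s k) := fun f s => by
    rw [← Finset.prod_pow]
    exact Finset.prod_congr rfl fun k _ => Real.sq_sqrt (noisyWeight_nonneg hw x h0 h1 f _)
  have hnn : ∀ (f : X → ℤˣ) (s : Fin n → I × ℤˣ), 0 ≤ ∏ k, √(noisyWeight w x h f (s k)) :=
    fun f s => Finset.prod_nonneg fun k _ => Real.sqrt_nonneg _
  have hone : ∀ f : X → ℤˣ,
      ∑ s : Fin n → I × ℤˣ, (∏ k, √(noisyWeight w x h f (s k))) ^ 2 ≤ 1 := fun f => by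
    simp only [hsq, sum_prod_noisyWeight hw1, le_refl]
  have hmain := half_sq_sum_mul_le (hnn f) (hnn g) (hone f) (hone g) hα hβ hαβ
  simp only [hsq, ← Finset.prod_mul_distrib] at hmain
  have e := Fintype.sum_pow (ι := I × ℤˣ)
    (fun z => √(noisyWeight w x h f z) * √(noisyWeight w x h g z)) n
  rw [← e, ← pow_mul] at hmain
  set D := ∑ i, w i * (if f (x i) = g (x i) then (0 : ℝ) else 1) with hD
  have hD0 : 0 ≤ D := Finset.sum_nonneg fun i _ => mul_nonneg (hw i) (by split_ifs <;> simp)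
  have hD1 : D ≤ 1 := by
    rw [← hw1]
    refine Finset.sum_le_sum fun i _ => ?_
    split_ifs <;> simp [hw i]
  have hhD : h ^ 2 * D ≤ 1 := mul_le_one₀ (pow_le_one₀ h0 h1) hD0 hD1
  have h2 : (1 : ℝ) / 2 ≤ (1 - h ^ 2 * D) ^ (n * 2) := by
    have := one_add_mul_le_pow (a := -(h ^ 2 * D)) (by linarith) (n * 2)
    rw [← sub_eq_add_neg] at this
    push_cast at this
    linarith
  have h3 := pow_le_pow_left₀ (by linarith) (one_sub_le_affinity hw hw1 x h0 h1 f g) (n * 2)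
  linarith

/-- One plus the chi-square divergence. Points of weight zero are harmless because `0 / 0 = 0`. -/
theorem sum_sq_div_noisyWeight {w : I → ℝ} (hw1 : ∑ i, w i = 1) (x : I → X)
    {h : ℝ} (h0 : 0 ≤ h) (h1 : h < 1) (f g : X → ℤˣ) :
    ∑ z, noisyWeight w x h f z ^ 2 / noisyWeight w x h g z =
      1 + 4 * h ^ 2 / (1 - h ^ 2) * ∑ i, w i * (if f (x i) = g (x i) then 0 else 1) := by
  have hsum : 1 + 4 * h ^ 2 / (1 - h ^ 2) * ∑ i, w i * (if f (x i) = g (x i) then (0 : ℝ) else 1) =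
      ∑ i, (w i + 4 * h ^ 2 / (1 - h ^ 2) * (w i * (if f (x i) = g (x i) then 0 else 1))) := by
    rw [Finset.sum_add_distrib, hw1, Finset.mul_sum]
  rw [Fintype.sum_prod_type, hsum]
  refine Finset.sum_congr rfl fun i _ => ?_
  have hp : 1 + h ≠ 0 := by linarith
  have hm : 1 - h ≠ 0 := by linarith
  have e : 1 - h ^ 2 = (1 + h) * (1 - h) := by ring
  rw [sum_units, e]
  by_cases hwi : w i = 0
  · simp [noisyWeight, hwi]
  rcases Int.units_eq_one_or (f (x i)) with hf | hf <;>
    rcases Int.units_eq_one_or (g (x i)) with hg | hg <;>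
    simp [noisyWeight, hf, hg, ← sub_eq_add_neg] <;> field_simp <;> ring

/-- Second moment bound for the average success probability of a test of several hypotheses. -/
theorem sum_success_le {w : I → ℝ} (hw : ∀ i, 0 ≤ w i) (hw1 : ∑ i, w i = 1) (x : I → X)
    {h : ℝ} (h0 : 0 ≤ h) (h1 : h < 1) {ι : Type*} [Fintype ι] (f : ι → X → ℤˣ) (g : X → ℤˣ) {n : ℕ}
    {D : ℝ} (hD : ∀ j, ∑ i, w i * (if f j (x i) = g (x i) then 0 else 1) ≤ D)
    {α : ι → (Fin n → I × ℤˣ) → ℝ} (hα : ∀ j s, α j s = 0 ∨ α j s = 1)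
    (hαs : ∀ s, ∑ j, α j s ≤ 1) :
    (∑ j, ∑ s, (∏ k, noisyWeight w x h (f j) (s k)) * α j s) ^ 2 ≤
      Fintype.card ι * (1 + 4 * h ^ 2 / (1 - h ^ 2) * D) ^ n := by
  have hh : 0 < 1 - h ^ 2 := by nlinarith
  have hc : 0 ≤ 4 * h ^ 2 / (1 - h ^ 2) := by positivity
  have hq : ∀ (f : X → ℤˣ) (s : Fin n → I × ℤˣ), 0 ≤ ∏ k, noisyWeight w x h f (s k) :=
    fun f s => Finset.prod_nonneg fun k _ => noisyWeight_nonneg hw x h0 h1.le f _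
  have hα0 : ∀ j s, 0 ≤ α j s := fun j s => by rcases hα j s with h | h <;> simp [h]
  -- Absolute continuity: since `h < 1`, a mass vanishes only where `w` does, whatever the
  -- classifier.
  have hzero : ∀ (j : ι) (s : Fin n → I × ℤˣ), ∏ k, noisyWeight w x h g (s k) = 0 →
      ∏ k, noisyWeight w x h (f j) (s k) = 0 := fun j s hs => by
    obtain ⟨k, hk, hk0⟩ := Finset.prod_eq_zero_iff.1 hs
    refine Finset.prod_eq_zero hk ?_
    have : 1 + h * (labelReal (s k).2 * labelReal (g (x (s k).1))) ≠ 0 := by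
      rw [labelReal_mul]
      split_ifs <;> linarith
    simp only [noisyWeight, mul_eq_zero, div_eq_zero_iff, this, OfNat.ofNat_ne_zero,
      or_false] at hk0
    simp [noisyWeight, hk0]
  -- Change of measure to the reference `g` by Cauchy–Schwarz, using `α² = α`. Under the single law
  -- of `g` the successes are mutually exclusive, so their total probability is at most 1.
  have hcs := Finset.sum_sq_le_sum_mul_sum_of_sq_le_mul
    (Finset.univ : Finset (ι × (Fin n → I × ℤˣ)))
    (r := fun t => (∏ k, noisyWeight w x h (f t.1) (t.2 k)) * α t.1 t.2)
    (f := fun t => (∏ k, noisyWeight w x h (f t.1) (t.2 k)) ^ 2 / ∏ k, noisyWeight w x h g (t.2 k))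
    (g := fun t => (∏ k, noisyWeight w x h g (t.2 k)) * α t.1 t.2)
    (fun t _ => div_nonneg (sq_nonneg _) (hq _ _)) (fun t _ => mul_nonneg (hq _ _) (hα0 _ _))
    (fun t _ => le_of_eq <| by
      by_cases ht : ∏ k, noisyWeight w x h g (t.2 k) = 0
      · simp [ht, hzero t.1 t.2 ht]
      · have : α t.1 t.2 ^ 2 = α t.1 t.2 := by rcases hα t.1 t.2 with h | h <;> simp [h]
        rw [mul_pow, this]
        field_simp)
  simp only [Fintype.sum_prod_type] at hcs
  have hA : ∑ j, ∑ s : Fin n → I × ℤˣ,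
      (∏ k, noisyWeight w x h (f j) (s k)) ^ 2 / ∏ k, noisyWeight w x h g (s k) ≤
      Fintype.card ι * (1 + 4 * h ^ 2 / (1 - h ^ 2) * D) ^ n := by
    rw [← nsmul_eq_mul, ← Finset.card_univ, ← Finset.sum_const]
    refine Finset.sum_le_sum fun j _ => ?_
    simp only [← Finset.prod_pow, ← Finset.prod_div_distrib]
    have e := Fintype.sum_pow (ι := I × ℤˣ)
      (fun z => noisyWeight w x h (f j) z ^ 2 / noisyWeight w x h g z) n
    rw [← e, sum_sq_div_noisyWeight hw1 x h0 h1]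
    have hD0 : 0 ≤ ∑ i, w i * (if f j (x i) = g (x i) then (0 : ℝ) else 1) :=
      Finset.sum_nonneg fun i _ => mul_nonneg (hw i) (by split_ifs <;> simp)
    gcongr
    exact hD j
  have hB : ∑ j, ∑ s : Fin n → I × ℤˣ, (∏ k, noisyWeight w x h g (s k)) * α j s ≤ 1 := by
    rw [Finset.sum_comm, ← sum_prod_noisyWeight hw1 x h g n]
    refine Finset.sum_le_sum fun s _ => ?_
    rw [← Finset.mul_sum]
    exact mul_le_of_le_one_right (hq _ _) (hαs s)
  refine hcs.trans ?_
  refine (mul_le_mul_of_nonneg_left hB (Finset.sum_nonneg fun j _ => Finset.sum_nonneg fun s _ =>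
    div_nonneg (sq_nonneg _) (hq _ _))).trans ?_
  rwa [mul_one]

end Tests

/-! ### Lower bounds from equally likely points and one uninformative point -/

section Padded

variable {X : Type u}

/-- The weights that give `m` points the mass `p` each, and the rest to an additional point. -/
def padWeight (m : ℕ) (p : ℝ) (o : Option (Fin m)) : ℝ := o.elim (1 - m * p) fun _ => p

/-- The points `xs`, together with an additional point `x₀`. -/
def padPoints {m : ℕ} (x₀ : X) (xs : Fin m → X) (o : Option (Fin m)) : X := o.elim x₀ xs

theorem padWeight_nonneg {m : ℕ} {p : ℝ} (hp : 0 ≤ p) (hmp : m * p ≤ 1) (o : Option (Fin m)) :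
    0 ≤ padWeight m p o := by
  cases o
  · simpa [padWeight] using hmp
  · simpa [padWeight] using hp

theorem sum_padWeight (m : ℕ) (p : ℝ) : ∑ o, padWeight m p o = 1 := by
  simp [Fintype.sum_option, padWeight]

theorem rhoH_eq_sum {m : ℕ} (xs : Fin m → X) (f g : X → ℤˣ) :
    (rhoH xs f g : ℝ) = ∑ i, if f (xs i) = g (xs i) then 0 else 1 := by
  simp only [rhoH, hammingDist, Finset.card_filter]
  push_cast
  refine Finset.sum_congr rfl fun i _ => ?_
  by_cases hi : f (xs i) = g (xs i) <;> simp [hi]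

theorem sum_padWeight_mul {m : ℕ} (p : ℝ) (x₀ : X) (xs : Fin m → X) (f g : X → ℤˣ) :
    ∑ o, padWeight m p o * (if f (padPoints x₀ xs o) = g (padPoints x₀ xs o) then 0 else 1) =
      (1 - m * p) * (if f x₀ = g x₀ then 0 else 1) + p * rhoH xs f g := by
  rw [Fintype.sum_option, rhoH_eq_sum, Finset.mul_sum]
  rfl

theorem mul_rhoH_le_sum {m : ℕ} {p : ℝ} (hmp : m * p ≤ 1) {h : ℝ} (h0 : 0 ≤ h) (x₀ : X)
    (xs : Fin m → X) (f g : X → ℤˣ) :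
    h * p * rhoH xs f g ≤ ∑ o, padWeight m p o *
      (h * if f (padPoints x₀ xs o) = g (padPoints x₀ xs o) then 0 else 1) := by
  simp only [mul_left_comm _ h]
  rw [← Finset.mul_sum, sum_padWeight_mul, mul_assoc]
  refine mul_le_mul_of_nonneg_left (le_add_of_nonneg_left (mul_nonneg (by linarith) ?_)) h0
  split_ifs <;> simp

variable [MeasurableSpace X]

/-- The lower bound by Assouad's method. -/
theorem exists_lower_bound_of_cube {F : Set (X → ℤˣ)} (hF : ∀ f ∈ F, Measurable f) {k n : ℕ}
    {p h : ℝ} (hp : 0 ≤ p) (hkp : k * p ≤ 1) (h0 : 0 < h) (h1 : h ≤ 1)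
    (hn : 4 * n * (h ^ 2 * p) ≤ 1) (xs : Fin k → X) (x₀ : X) (f : (Fin k → ℤˣ) → X → ℤˣ)
    (hfF : ∀ σ, f σ ∈ F) (hfx : ∀ σ i, f σ (xs i) = σ i) (hf₀ : ∀ σ τ, f σ x₀ = f τ x₀)
    {Ω : Type v} [MeasurableSpace Ω] (ν : Measure Ω) [IsProbabilityMeasure ν] (A : Learner X Ω n) :
    ∃ P ∈ massartClass h F, ∀ fstar : X → ℤˣ, IsBayesClassifier P fstar →
      Integrable (fun p => risk P (A.output p.1 p.2) - risk P fstar) (trainingLaw ν P n) ∧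
      h * p * (k / 8) ≤ ∫ p, (risk P (A.output p.1 p.2) - risk P fstar) ∂(trainingLaw ν P n) := by
  let _ : MeasurableSpace (Option (Fin k)) := ⊤
  have : DiscreteMeasurableSpace (Option (Fin k)) := ⟨fun _ => trivial⟩
  have hw := padWeight_nonneg hp hkp
  have hw1 := sum_padWeight k p
  refine exists_massart_lower_bound hw hw1 (padPoints x₀ xs) h0 h1
    (fun σ => hF _ (hfF σ)) hfF (fun a => ?_) ν A
  set q : (Fin k → ℤˣ) → (Fin n → Option (Fin k) × ℤˣ) → ℝ := fun σ s =>
    ∏ l, noisyWeight (padWeight k p) (padPoints x₀ xs) h (f σ) (s l) with hq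
  have hq0 : ∀ σ s, 0 ≤ q σ s := fun σ s =>
    Finset.prod_nonneg fun l _ => noisyWeight_nonneg hw _ h0.le h1 _ _
  set D : Fin k → (Fin k → ℤˣ) → ℝ := fun i σ =>
    ∑ s, q σ s * if a s (xs i) = σ i then 0 else 1 with hD
  let flip (i : Fin k) (σ : Fin k → ℤˣ) : Fin k → ℤˣ := Function.update σ i (-σ i)
  have hflip : ∀ i, Function.Involutive (flip i) := fun i σ => by
    funext j
    by_cases hj : j = i
    · subst hj; simp [flip]
    · simp [flip, hj]
  -- The two classifiers differ on the support only at `xs i`, of mass `p`, and any prediction there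
  -- is wrong for one of them.
  have hpair : ∀ i σ, 1 / 4 ≤ D i σ + D i (flip i σ) := fun i σ => by
    refine half_affinity_le_error hw hw1 _ h0.le h1 (f σ) (f (flip i σ)) ?_
      (fun s => by split_ifs <;> simp) (fun s => by split_ifs <;> simp) (fun s => ?_)
    · rw [sum_padWeight_mul, if_pos (hf₀ _ _), mul_zero, zero_add, rhoH_eq_sum]
      simp only [hfx]
      rw [Finset.sum_eq_single i (fun j _ hj => by simp [flip, hj]) (by simp)]
      simpa [flip, units_ne_neg_self] using hn
    · rcases Int.units_eq_one_or (a s (xs i)) with h2 | h2 <;>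
        rcases Int.units_eq_one_or (σ i) with h3 | h3 <;> simp [flip, h2, h3]
  have hDsum : ∀ i, (Fintype.card (Fin k → ℤˣ) : ℝ) * (1 / 8) ≤ ∑ σ, D i σ := fun i => by
    have e : ∑ σ, D i (flip i σ) = ∑ σ, D i σ :=
      Equiv.sum_comp (Function.Involutive.toPerm _ (hflip i)) (D i)
    have h2 : ∑ σ : Fin k → ℤˣ, (1 / 4 : ℝ) ≤ ∑ σ, (D i σ + D i (flip i σ)) :=
      Finset.sum_le_sum fun σ _ => hpair i σ
    rw [Finset.sum_add_distrib, e, Finset.sum_const, Finset.card_univ, nsmul_eq_mul] at h2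
    linarith
  calc (Fintype.card (Fin k → ℤˣ) : ℝ) * (h * p * (k / 8))
      = h * p * ∑ i : Fin k, (Fintype.card (Fin k → ℤˣ) : ℝ) * (1 / 8) := by
        rw [Finset.sum_const, Finset.card_univ, Fintype.card_fin, nsmul_eq_mul]
        ring
    _ ≤ h * p * ∑ i, ∑ σ, D i σ :=
        mul_le_mul_of_nonneg_left (Finset.sum_le_sum fun i _ => hDsum i) (by positivity)
    _ = ∑ σ, ∑ s, q σ s * (h * p * rhoH xs (a s) (f σ)) := by
        rw [Finset.sum_comm, Finset.mul_sum]
        refine Finset.sum_congr rfl fun σ _ => ?_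
        simp only [hD]
        rw [Finset.sum_comm, Finset.mul_sum]
        refine Finset.sum_congr rfl fun s _ => ?_
        rw [rhoH_eq_sum, ← Finset.mul_sum]
        simp only [hfx]
        ring
    _ ≤ _ := Finset.sum_le_sum fun σ _ => Finset.sum_le_sum fun s _ =>
        mul_le_mul_of_nonneg_left (mul_rhoH_le_sum hkp h0.le x₀ xs _ _) (hq0 σ s)

/-- The lower bound by testing between the members of a packing. -/
theorem exists_lower_bound_of_packing {F : Set (X → ℤˣ)} (hF : ∀ f ∈ F, Measurable f) {m n : ℕ}
    {p h ε R : ℝ} (hp : 0 ≤ p) (hmp : m * p ≤ 1) (h0 : 0 < h) (h1 : h < 1) (hε : 0 ≤ ε)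
    (xs : Fin m → X) (x₀ : X) {T : Finset (X → ℤˣ)} (hT : IsPacking xs F (ε / 2) T)
    (hTR : ∀ f ∈ T, ∀ g ∈ T, (rhoH xs f g : ℝ) ≤ R) (hT₀ : ∀ f ∈ T, ∀ g ∈ T, f x₀ = g x₀)
    (hTne : T.Nonempty) (hcard : 4 * (1 + 4 * h ^ 2 / (1 - h ^ 2) * (p * R)) ^ n ≤ T.card)
    {Ω : Type v} [MeasurableSpace Ω] (ν : Measure Ω) [IsProbabilityMeasure ν] (A : Learner X Ω n) :
    ∃ P ∈ massartClass h F, ∀ fstar : X → ℤˣ, IsBayesClassifier P fstar →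
      Integrable (fun p => risk P (A.output p.1 p.2) - risk P fstar) (trainingLaw ν P n) ∧
      h * p * (ε / 8) ≤ ∫ p, (risk P (A.output p.1 p.2) - risk P fstar) ∂(trainingLaw ν P n) := by
  classical
  let _ : MeasurableSpace (Option (Fin m)) := ⊤
  have : DiscreteMeasurableSpace (Option (Fin m)) := ⟨fun _ => trivial⟩
  have : Nonempty T := hTne.to_subtype
  obtain ⟨g, hg⟩ := hTne
  have hw := padWeight_nonneg hp hmp
  have hw1 := sum_padWeight m p
  refine exists_massart_lower_bound hw hw1 (padPoints x₀ xs) h0 h1.le (ι := T)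
    (f := fun j => j.1) (fun j => hF _ (hT.1 j.2)) (fun j => hT.1 j.2) (fun a => ?_) ν A
  set q : T → (Fin n → Option (Fin m) × ℤˣ) → ℝ := fun j s =>
    ∏ l, noisyWeight (padWeight m p) (padPoints x₀ xs) h j.1 (s l) with hq
  have hq0 : ∀ j s, 0 ≤ q j s := fun j s =>
    Finset.prod_nonneg fun l _ => noisyWeight_nonneg hw _ h0.le h1.le _ _
  set α : T → (Fin n → Option (Fin m) × ℤˣ) → ℝ := fun j s =>
    if (rhoH xs (a s) j.1 : ℝ) ≤ ε / 4 then 1 else 0 with hα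
  -- Success means output within half the packing separation, so it decodes at most one member.
  have huniq : ∀ s (i j : T), (rhoH xs (a s) i.1 : ℝ) ≤ ε / 4 →
      (rhoH xs (a s) j.1 : ℝ) ≤ ε / 4 → i = j := fun s i j hi hj => by
    by_contra hij
    have h2 := hT.2 i.2 j.2 fun hval => hij (Subtype.ext hval)
    have h3 : (rhoH xs i.1 j.1 : ℝ) ≤ rhoH xs (a s) i.1 + rhoH xs (a s) j.1 := by
      exact_mod_cast hammingDist_triangle_left _ _ fun l => a s (xs l)
    linarith
  have hαs : ∀ s, ∑ j, α j s ≤ 1 := fun s => by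
    by_cases hs : ∃ j : T, (rhoH xs (a s) j.1 : ℝ) ≤ ε / 4
    · obtain ⟨j, hj⟩ := hs
      rw [Finset.sum_eq_single j (fun i _ hij => if_neg fun hi => hij (huniq s i j hi hj)) (by simp)]
      exact (if_pos hj).le
    · push Not at hs
      rw [Finset.sum_eq_zero fun j _ => if_neg (not_le.2 (hs j))]
      exact zero_le_one
  have hsucc := sum_success_le hw hw1 (padPoints x₀ xs) h0.le h1 (fun j : T => j.1) g (n := n)
    (D := p * R) (fun j => by
      rw [sum_padWeight_mul, if_pos (hT₀ _ j.2 _ hg), mul_zero, zero_add]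
      exact mul_le_mul_of_nonneg_left (hTR _ j.2 _ hg) hp)
    (α := α) (fun j s => by simp only [hα]; split_ifs <;> simp) hαs
  rw [Fintype.card_coe] at hsucc ⊢
  have hc : (0 : ℝ) ≤ T.card := Nat.cast_nonneg _
  -- Success has average probability at most `1/2`; each failure costs at least `h p ε / 4`.
  have hhalf : ∑ j, ∑ s, q j s * α j s ≤ T.card / 2 := by
    refine abs_le_of_sq_le_sq' ?_ (by positivity) |>.2
    refine hsucc.trans ?_
    nlinarith [mul_le_mul_of_nonneg_left hcard hc]
  have htot : ∑ j, ∑ s, q j s = (T.card : ℝ) := by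
    simp only [hq]
    rw [Finset.sum_congr rfl fun j _ => sum_prod_noisyWeight hw1 _ _ _ _]
    simp
  calc (T.card : ℝ) * (h * p * (ε / 8)) = h * p * (ε / 4) * (T.card - T.card / 2) := by ring
    _ ≤ h * p * (ε / 4) * (∑ j, ∑ s, q j s - ∑ j, ∑ s, q j s * α j s) := by
        rw [htot]
        gcongr
    _ = ∑ j, ∑ s, q j s * (h * p * (ε / 4 * (1 - α j s))) := by
        simp only [← Finset.sum_sub_distrib, Finset.mul_sum]
        refine Finset.sum_congr rfl fun j _ => Finset.sum_congr rfl fun s _ => ?_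
        ring
    _ ≤ _ := Finset.sum_le_sum fun j _ => Finset.sum_le_sum fun s _ =>
        mul_le_mul_of_nonneg_left (le_trans (mul_le_mul_of_nonneg_left ?_ (by positivity))
          (mul_rhoH_le_sum hmp h0.le x₀ xs _ _)) (hq0 j s)
  simp only [hα]
  split_ifs with hjs
  · simp
  · linarith

end Padded

/-! ### Combinatorics of shattering and of pseudoconvexity -/

section Class

variable {X : Type u} {F : Set (X → ℤˣ)}

theorem one_le_tlog (t : ℝ) : 1 ≤ tlog t :=
  (Real.le_log_iff_exp_le (lt_max_of_lt_right (Real.exp_pos 1))).2 (le_max_right _ _)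

theorem exists_isPacking_card_eq {N : ℕ} (x : Fin N → X) (H : Set (X → ℤˣ)) {ε : ℝ} (hε : 0 ≤ ε) :
    ∃ T, IsPacking x H ε T ∧ T.card = packingNumber x H ε :=
  Nat.sSup_mem (s := {k | ∃ T, IsPacking x H ε T ∧ T.card = k})
    ⟨0, ∅, ⟨by simp, by simp⟩, rfl⟩
    ⟨2 ^ N, by rintro k ⟨T, hT, rfl⟩; exact hT.card_le hε⟩

theorem IsPacking.card_le_packingNumber {N : ℕ} {x : Fin N → X} {H : Set (X → ℤˣ)} {ε : ℝ}
    (hε : 0 ≤ ε) {T : Finset (X → ℤˣ)} (hT : IsPacking x H ε T) :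
    T.card ≤ packingNumber x H ε :=
  le_csSup ⟨2 ^ N, by rintro k ⟨T, hT, rfl⟩; exact hT.card_le hε⟩ ⟨T, hT, rfl⟩

theorem packingNumber_le_localPacking {N : ℕ} (x : Fin N → X) {f : X → ℤˣ} (hf : f ∈ F)
    {γ ε : ℝ} (hγ : 0 ≤ γ) (hε : γ ≤ ε) (h : ℝ) :
    packingNumber x (hammingBall x F f (ε / h)) (ε / 2) ≤ localPacking F γ N h := by
  refine le_csSup ⟨2 ^ N, ?_⟩ ⟨x, f, hf, ε, hε, rfl⟩
  rintro k ⟨x, f, -, ε, hε, rfl⟩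
  exact packingNumber_le x _ (by linarith)

theorem mul_gammaLoc_le {h : ℝ} (hh : 0 < h) (h' : ℝ) (N : ℕ) (F : Set (X → ℤˣ)) :
    h * (gammaLoc h h' N F : ℝ) ≤ tlog (localPacking F (gammaLoc h h' N F : ℝ) N h') :=
  Nat.sSup_mem (s := {γ : ℕ | h * (γ : ℝ) ≤ tlog (localPacking F (γ : ℝ) N h')})
    ⟨0, by simpa using zero_le_one.trans (one_le_tlog _)⟩ (bddAbove_gammaLoc hh h' N F)

/-- A pseudoconvex class does not consist of two opposite classifiers. -/
theorem IsPseudoconvex.exists_ne_eq {h c : ℝ} (hh : 0 < h) (hF : IsPseudoconvex F h c) {u : X}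
    (hu : Shatters F {u}) : ∃ f ∈ F, ∃ g ∈ F, ∃ a b, f a ≠ g a ∧ f b = g b := by
  classical
  by_contra! hcon
  obtain ⟨f, hf, hfu⟩ := hu fun _ => 1
  obtain ⟨g, hg, hgu⟩ := hu fun _ => -1
  have hfg : f u ≠ g u := by
    rw [hfu u (by simp), hgu u (by simp)]
    decide
  -- If members of `F` are equal or opposite, packings have at most two members, so truncation of
  -- the logarithm forces `h γ ≤ 1`. This `N` then exceeds `c γ`: radius `N` captures an opposite
  -- pair, but no radius up to `c γ` does.
  obtain ⟨N, hN⟩ := exists_nat_gt (c / h)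
  have hc0 : 0 < c := lt_of_lt_of_le one_pos hF.1
  have hNpos : (0 : ℝ) < N := (div_pos hc0 hh).trans hN
  have hsep : ∀ {x : Fin N → X} {f g : X → ℤˣ} {ε : ℝ}, 0 ≤ ε → ε < (rhoH x f g : ℝ) →
      ∃ a, f a ≠ g a := by
    intro x f g ε hε hlt
    by_contra! heq
    have : rhoH x f g = 0 := hammingDist_eq_zero.2 (funext fun i => heq (x i))
    rw [this] at hlt
    norm_num at hlt
    linarith
  have htwo : ∀ {x : Fin N → X} {H : Set (X → ℤˣ)} {ε : ℝ}, 0 ≤ ε → H ⊆ F →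
      packingNumber x H ε ≤ 2 := by
    intro x H ε hε hHF
    obtain ⟨T, hT, hTc⟩ := exists_isPacking_card_eq x H hε
    rw [← hTc]
    have hinj : Set.InjOn (fun f : X → ℤˣ => f u) (T : Set (X → ℤˣ)) := by
      intro a ha b hb hab
      by_contra hne
      obtain ⟨t, ht⟩ := hsep hε (hT.2 ha hb hne)
      exact hcon a (hHF (hT.1 ha)) b (hHF (hT.1 hb)) t u ht hab
    calc T.card = (T.image fun f : X → ℤˣ => f u).card := (Finset.card_image_of_injOn hinj).symm
      _ ≤ Fintype.card ℤˣ := Finset.card_le_univ _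
      _ = 2 := by simp
  set γ := gammaLoc h 1 N F with hγ
  have hγh : h * (γ : ℝ) ≤ 1 := by
    refine (mul_gammaLoc_le hh 1 N F).trans ?_
    have h2 : localPacking F (γ : ℝ) N 1 ≤ 2 := by
      apply csSup_le'
      rintro k ⟨x, f, -, ε, hε, rfl⟩
      exact htwo (by have := (Nat.cast_nonneg γ : (0 : ℝ) ≤ γ); linarith) fun g hg => hg.1
    have h3 : (localPacking F (γ : ℝ) N 1 : ℝ) ≤ Real.exp 1 := by
      have : (localPacking F (γ : ℝ) N 1 : ℝ) ≤ 2 := by exact_mod_cast h2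
      linarith [Real.add_one_le_exp (1 : ℝ)]
    rw [← hγ, tlog, max_eq_right h3, Real.log_exp]
  have hcγ : c * (γ : ℝ) < N := by
    refine lt_of_le_of_lt ?_ hN
    rw [le_div_iff₀ hh]
    nlinarith
  have hγ0 : (0 : ℝ) ≤ γ := Nat.cast_nonneg γ
  have hγN : (γ : ℝ) ≤ N := by nlinarith [hF.1]
  have hall : ∀ (x : Fin N → X) {f g : X → ℤˣ}, f ∈ F → g ∈ F → ∀ {a}, f a ≠ g a →
      (rhoH x f g : ℝ) = N := by
    intro x f g hf hg a ha
    rw [rhoH_eq_sum, Finset.sum_congr rfl fun i _ => if_neg (hcon f hf g hg a (x i) ha)]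
    simp
  have hlow : 2 ≤ localPacking F (γ : ℝ) N 1 := by
    refine le_trans ?_ (packingNumber_le_localPacking (fun _ : Fin N => u) hf hγ0 hγN 1)
    have hne : f ≠ g := fun e => hfg (by rw [e])
    rw [← Finset.card_pair hne]
    refine IsPacking.card_le_packingNumber (by positivity) ⟨?_, ?_⟩
    · intro t ht
      simp only [Finset.coe_insert, Finset.coe_singleton, Set.mem_insert_iff,
        Set.mem_singleton_iff] at ht
      rcases ht with rfl | rfl
      · exact ⟨hf, by rw [rhoH, hammingDist_self]; simp⟩
      · exact ⟨hg, by rw [hall _ hf hg hfg]; simp⟩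
    · rw [Finset.coe_pair, Set.pairwise_pair]
      intro _
      rw [hall _ hf hg hfg, hall _ hg hf hfg.symm]
      exact ⟨by linarith, by linarith⟩
  obtain ⟨x, f', hf', ε, hε1, hε2, hpk⟩ := hF.2 N
  rw [← hγ] at hε1 hε2 hpk
  obtain ⟨T, hT, hTc⟩ := exists_isPacking_card_eq x (hammingBall x F f' (ε / 1))
    (show 0 ≤ ε / 2 by linarith)
  obtain ⟨a, ha, b, hb, hab⟩ := Finset.one_lt_card.1 (show 1 < T.card by omega)
  obtain ⟨t, ht⟩ := hsep (by linarith) (hT.2 ha hb hab)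
  have hball : ∀ e ∈ T, f' t = e t := by
    intro e he
    by_contra hne
    have h2 := (hT.1 he).2
    rw [hall x hf' (hT.1 he).1 hne] at h2
    linarith
  exact ht ((hball a ha).symm.trans (hball b hb))

/-- A class of positive finite VC dimension that is pseudoconvex realizes all labellings of at least
half as many points by classifiers that agree on one more point. -/
theorem exists_cube {h c : ℝ} (hh : 0 < h) (hpc : IsPseudoconvex F h c) {d : ℕ} (hd : 1 ≤ d)
    (hF : HasVCDim F d) :
    ∃ k, k ≤ d ∧ d ≤ 2 * k ∧ ∃ (xs : Fin k → X) (x₀ : X) (f : (Fin k → ℤˣ) → X → ℤˣ),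
      (∀ σ, f σ ∈ F) ∧ (∀ σ i, f σ (xs i) = σ i) ∧ ∀ σ τ, f σ x₀ = f τ x₀ := by
  classical
  obtain ⟨S, hS, hsh⟩ := hF.1
  obtain ⟨x₀, hx₀⟩ := Finset.card_pos.1 (show 0 < S.card by omega)
  rcases hd.eq_or_lt with hd1 | hd2
  -- A single shattered point cannot be spared as `x₀`, so the common point must come from
  -- pseudoconvexity.
  · obtain ⟨u, rfl⟩ := Finset.card_eq_one.1 (hS.trans hd1.symm)
    obtain ⟨f, hf, g, hg, a, b, hab, hb⟩ := hpc.exists_ne_eq hh hsh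
    refine ⟨1, hd, by omega, fun _ => a, b, fun σ => if f a = σ 0 then f else g, fun σ => ?_,
      fun σ i => ?_, fun σ τ => ?_⟩
    · dsimp only
      split_ifs <;> assumption
    · rw [Fin.fin_one_eq_zero i]
      dsimp only
      split_ifs with hσ
      · exact hσ
      · rcases Int.units_eq_one_or (f a) with h1 | h1 <;>
          rcases Int.units_eq_one_or (g a) with h2 | h2 <;>
          rcases Int.units_eq_one_or (σ 0) with h3 | h3 <;> simp_all
    · dsimp only
      split_ifs <;> simp [hb]
  · have hcard : (S.erase x₀).card = d - 1 := by rw [Finset.card_erase_of_mem hx₀, hS]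
    let e := (S.erase x₀).equivFinOfCardEq hcard
    choose f hf hfy using hsh
    refine ⟨d - 1, by omega, by omega, fun i => (e.symm i : X), x₀,
      fun σ => f fun t => if ht : t ∈ S.erase x₀ then σ (e ⟨t, ht⟩) else 1, fun σ => hf _,
      fun σ i => ?_, fun σ τ => ?_⟩
    · dsimp only
      have hmem := (e.symm i).2
      rw [hfy _ _ (Finset.mem_of_mem_erase hmem), dif_pos hmem]
      simp
    · dsimp only
      rw [hfy _ _ hx₀, hfy _ _ hx₀, dif_neg (Finset.notMem_erase x₀ S),
        dif_neg (Finset.notMem_erase x₀ S)]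

/-- Pigeonhole on the label at `x₀`. -/
theorem IsPacking.exists_half {N : ℕ} {x : Fin N → X} {H : Set (X → ℤˣ)} {ε : ℝ}
    {T : Finset (X → ℤˣ)} (hT : IsPacking x H ε T) (x₀ : X) :
    ∃ T' : Finset (X → ℤˣ), T.card ≤ 2 * T'.card ∧ IsPacking x H ε T' ∧ ∀ f ∈ T', ∀ g ∈ T', f x₀ = g x₀ := by
  classical
  obtain ⟨y, -, hy⟩ : ∃ y ∈ (Finset.univ : Finset ℤˣ),
      T.card ≤ 2 * (T.filter fun f => f x₀ = y).card := by
    by_contra! hlt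
    have h1 := Finset.card_eq_sum_card_fiberwise (s := T) (f := fun f : X → ℤˣ => f x₀)
      (t := Finset.univ) (fun _ _ => Finset.mem_coe.2 (Finset.mem_univ _))
    rw [UnitsInt.univ, Finset.sum_pair (by decide)] at h1
    have h2 := hlt 1 (by simp)
    have h3 := hlt (-1) (by simp)
    omega
  refine ⟨T.filter fun f => f x₀ = y, hy,
    ⟨fun f hf => hT.1 (Finset.mem_of_mem_filter f hf), hT.2.mono (Finset.filter_subset _ _)⟩, ?_⟩
  intro f hf g hg
  rw [(Finset.mem_filter.1 hf).2, (Finset.mem_filter.1 hg).2]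

end Class

/-! ### The two lower bounds -/

section LowerBounds

variable {X : Type u} [MeasurableSpace X] {F : Set (X → ℤˣ)}

theorem exists_lower_bound_vcDim (hFm : ∀ f ∈ F, Measurable f) {d n : ℕ} {h c : ℝ}
    (hF : HasVCDim F d) (hd : 1 ≤ d) (hn : 1 ≤ n) (hdn : √((d : ℝ) / n) ≤ h) (h1 : h ≤ 1)
    (hpc : IsPseudoconvex F h c)
    {Ω : Type v} [MeasurableSpace Ω] (ν : Measure Ω) [IsProbabilityMeasure ν] (A : Learner X Ω n) :
    ∃ P ∈ massartClass h F, ∀ fstar : X → ℤˣ, IsBayesClassifier P fstar →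
      Integrable (fun p => risk P (A.output p.1 p.2) - risk P fstar) (trainingLaw ν P n) ∧
      1 / 64 * ((d : ℝ) / (n * h)) ≤
        ∫ p, (risk P (A.output p.1 p.2) - risk P fstar) ∂(trainingLaw ν P n) := by
  have hn0 : (0 : ℝ) < n := by exact_mod_cast hn
  have hd0 : (0 : ℝ) < d := by exact_mod_cast hd
  have h0 : 0 < h := (Real.sqrt_pos.2 (div_pos hd0 hn0)).trans_le hdn
  obtain ⟨k, hkd, hdk, xs, x₀, f, hfF, hfx, hf₀⟩ := exists_cube h0 hpc hd hF
  have hdnh : (d : ℝ) ≤ n * h ^ 2 := by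
    have := (Real.sqrt_le_left h0.le).1 hdn
    rw [div_le_iff₀ hn0] at this
    linarith
  have hk : (k : ℝ) ≤ d := by exact_mod_cast hkd
  -- The largest mass that the two-point test permits; the total is at most 1 because `k ≤ d ≤ n
  -- h²`.
  obtain ⟨P, hP, hbound⟩ := exists_lower_bound_of_cube hFm (p := 1 / (4 * n * h ^ 2)) (by positivity)
    (by rw [mul_one_div, div_le_one (by positivity)]; linarith) h0 h1
    (by field_simp; exact le_refl _) xs x₀ f hfF hfx hf₀ ν A
  refine ⟨P, hP, fun fstar hstar => ⟨(hbound fstar hstar).1, le_trans ?_ (hbound fstar hstar).2⟩⟩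
  have hdk' : (d : ℝ) ≤ 2 * k := by exact_mod_cast hdk
  have e : h * (1 / (4 * n * h ^ 2)) * ((k : ℝ) / 8) = 1 / 64 * (2 * k / (n * h)) := by
    field_simp
    ring
  rw [e]
  gcongr

theorem exists_lower_bound_gammaLoc (hFm : ∀ f ∈ F, Measurable f) {n N : ℕ} {h c : ℝ}
    (h0 : 0 < h) (h1 : h < 1) (hnh : 1 ≤ n * h) (hpc : IsPseudoconvex F h c)
    (hN : N = ⌈(n : ℝ) * c * h / (1 - h)⌉₊) (hγ : 5 < h * gammaLoc h 1 N F)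
    {Ω : Type v} [MeasurableSpace Ω] (ν : Measure Ω) [IsProbabilityMeasure ν] (A : Learner X Ω n) :
    ∃ P ∈ massartClass h F, ∀ fstar : X → ℤˣ, IsBayesClassifier P fstar →
      Integrable (fun p => risk P (A.output p.1 p.2) - risk P fstar) (trainingLaw ν P n) ∧
      1 / 256 * (1 / c * ((1 - h) * (gammaLoc h 1 N F : ℝ) / n)) ≤
        ∫ p, (risk P (A.output p.1 p.2) - risk P fstar) ∂(trainingLaw ν P n) := by
  obtain ⟨hc, hpc⟩ := hpc
  obtain ⟨xs, f₀, -, ε, hε1, hε2, hpk⟩ := hpc N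
  have hlog := mul_gammaLoc_le h0 1 N F
  rw [← hpk] at hlog
  set γ : ℝ := (gammaLoc h 1 N F : ℝ) with hγdef
  have hγ0 : 0 < γ := by
    by_contra! hneg
    nlinarith
  have hε : 0 < ε := hγ0.trans_le hε1
  have hm : 0 < 1 - h := by linarith
  have hn0 : (0 : ℝ) < n := by
    by_contra! hneg
    nlinarith
  have hratio : 1 ≤ (n : ℝ) * c * h / (1 - h) := by
    rw [le_div_iff₀ hm]
    nlinarith
  have hN1 : (n : ℝ) * c * h / (1 - h) ≤ N := hN ▸ Nat.le_ceil _
  have hN2 : (N : ℝ) ≤ 2 * ((n : ℝ) * c * h / (1 - h)) := by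
    have := Nat.ceil_lt_add_one (zero_le_one.trans hratio)
    rw [← hN] at this
    linarith
  have hN0 : (0 : ℝ) < N := by linarith
  obtain ⟨T, hT, hTc⟩ := exists_isPacking_card_eq xs (hammingBall xs F f₀ (ε / 1))
    (show 0 ≤ ε / 2 by linarith)
  rw [← hTc] at hlog
  have hexp : Real.exp (h * γ) ≤ T.card := by
    have h2 : ¬(T.card : ℝ) ≤ Real.exp 1 := fun hle => by
      rw [tlog, max_eq_right hle, Real.log_exp] at hlog
      linarith
    push Not at h2
    rw [tlog, max_eq_left h2.le] at hlog
    exact (Real.le_log_iff_exp_le ((Real.exp_pos 1).trans h2)).1 hlog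
  have hsq : Real.exp (h * γ) = Real.exp (h * γ / 2) ^ 2 := by
    rw [← Real.exp_nat_mul]
    congr 1
    push_cast
    ring
  -- Half of the packing has at least `exp (h γ) / 2` members, which is then at least `4 exp (h γ /
  -- 2)`.
  have h8 : 8 ≤ Real.exp (h * γ / 2) := by
    refine (sq_le_sq₀ (by norm_num) (Real.exp_pos _).le).1 ?_
    rw [← hsq]
    have h5 : Real.exp 1 ^ 5 ≤ Real.exp (h * γ) := by
      rw [← Real.exp_nat_mul]
      exact Real.exp_le_exp.2 (by push_cast; linarith)
    have h27 : (2.7 : ℝ) ^ 5 ≤ Real.exp 1 ^ 5 :=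
      pow_le_pow_left₀ (by norm_num) (by linarith [Real.exp_one_gt_d9]) 5
    exact le_trans (by norm_num) (h27.trans h5)
  have hNpos : 0 < N := by exact_mod_cast hN0
  obtain ⟨T', hhalf, hT', hT'₀⟩ := hT.exists_half (xs ⟨0, hNpos⟩)
  have hhalf' : (T.card : ℝ) ≤ 2 * T'.card := by exact_mod_cast hhalf
  have hT'0 : (0 : ℝ) < T'.card := by linarith [Real.exp_pos (h * γ)]
  have hdiam : ∀ f ∈ T', ∀ g ∈ T', (rhoH xs f g : ℝ) ≤ 2 * (c * γ) := by
    intro f hf g hg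
    have h2 := (hT'.1 hf).2
    have h3 := (hT'.1 hg).2
    rw [div_one] at h2 h3
    have h4 : (rhoH xs f g : ℝ) ≤ rhoH xs f₀ f + rhoH xs f₀ g := by
      exact_mod_cast hammingDist_triangle_left _ _ fun l => f₀ (xs l)
    linarith
  have hh2 : 0 < 1 - h ^ 2 := by nlinarith
  -- The mass `1 / (16 N)` and `N ≥ n c h / (1 - h)` keep the `n`-fold second moment below `exp (h γ
  -- / 2)`.
  have hmoment : 4 * (1 + 4 * h ^ 2 / (1 - h ^ 2) * (1 / (16 * N) * (2 * (c * γ)))) ^ n ≤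
      (T'.card : ℝ) := by
    have h2 : n * (4 * h ^ 2 / (1 - h ^ 2) * (1 / (16 * N) * (2 * (c * γ)))) ≤ h * γ / 2 := by
      have e : n * (4 * h ^ 2 / (1 - h ^ 2) * (1 / (16 * N) * (2 * (c * γ)))) =
          h * γ / 2 * (n * c * h / ((1 - h ^ 2) * N)) := by
        field_simp
        norm_num
      rw [e]
      refine mul_le_of_le_one_right (by positivity) ?_
      rw [div_le_one (by positivity)]
      rw [div_le_iff₀ hm] at hN1
      nlinarith [mul_pos (mul_pos h0 hm) hN0]
    have h3 : (1 + 4 * h ^ 2 / (1 - h ^ 2) * (1 / (16 * N) * (2 * (c * γ)))) ^ n ≤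
        Real.exp (h * γ / 2) := by
      refine (pow_le_pow_left₀ (b := Real.exp (4 * h ^ 2 / (1 - h ^ 2) * (1 / (16 * N) * (2 * (c * γ)))))
        (by positivity) ?_ n).trans ?_
      · rw [add_comm]
        exact Real.add_one_le_exp _
      · rw [← Real.exp_nat_mul]
        exact Real.exp_le_exp.2 h2
    nlinarith
  obtain ⟨P, hP, hbound⟩ := exists_lower_bound_of_packing hFm (p := 1 / (16 * N)) (by positivity)
    (by rw [mul_one_div, div_le_one (by positivity)]; linarith) h0 h1 hε.le xs _
    ⟨hT'.1.trans fun f hf => hf.1, hT'.2⟩ hdiam hT'₀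
    (Finset.card_pos.1 (by exact_mod_cast hT'0)) hmoment ν A
  refine ⟨P, hP, fun fstar hstar => ⟨(hbound fstar hstar).1, le_trans ?_ (hbound fstar hstar).2⟩⟩
  have e1 : 1 / 256 * (1 / c * ((1 - h) * γ / n)) =
      h * (1 / (16 * (2 * (n * c * h / (1 - h))))) * (γ / 8) := by
    field_simp
    norm_num
  rw [e1]
  gcongr

end LowerBounds

end LocalEntropy

end

/-- Minimax lower bound under bounded noise, with a universal constant `C`. For `h = 1` the second
summand is zero, whatever the argument of the fixed point. -/
theorem theorem6p1 :
    ∃ C : ℝ, 0 < C ∧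
      ∀ (X : Type u) [MeasurableSpace X] (F : Set (X → ℤˣ)) (d n : ℕ) (h c : ℝ),
        (∀ f ∈ F, Measurable f) →
        LocalEntropy.HasVCDim F d → 1 ≤ d → 1 ≤ n →
        Real.sqrt ((d : ℝ) / (n : ℝ)) ≤ h → h ≤ 1 →
        LocalEntropy.IsPseudoconvex F h c →
        ∀ (Ω : Type v) [MeasurableSpace Ω] (ν : Measure Ω) [IsProbabilityMeasure ν]
          (A : LocalEntropy.Learner X Ω n),
          ∃ P ∈ LocalEntropy.massartClass h F,
            ∀ fstar : X → ℤˣ, LocalEntropy.IsBayesClassifier P fstar →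
              Integrable
                (fun p => LocalEntropy.risk P (A.output p.1 p.2) - LocalEntropy.risk P fstar)
                (LocalEntropy.trainingLaw ν P n) ∧
              C * ((d : ℝ) / ((n : ℝ) * h) +
                  (1 / c) *
                    ((1 - h) *
                      (LocalEntropy.gammaLoc h 1 ⌈(n : ℝ) * c * h / (1 - h)⌉₊ F : ℝ) / (n : ℝ))) ≤
                ∫ p, (LocalEntropy.risk P (A.output p.1 p.2) - LocalEntropy.risk P fstar)
                  ∂(LocalEntropy.trainingLaw ν P n) := by
  refine ⟨1 / 1000, by norm_num, ?_⟩
  intro X _ F d n h c hFm hF hd hn hdn h1 hpc Ω _ ν _ A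
  have hn0 : (0 : ℝ) < n := by exact_mod_cast hn
  have hd1 : (1 : ℝ) ≤ d := by exact_mod_cast hd
  have h0 : 0 < h := (Real.sqrt_pos.2 (div_pos (by linarith) hn0)).trans_le hdn
  have hc : 1 ≤ c := hpc.1
  set γ : ℝ := (LocalEntropy.gammaLoc h 1 ⌈(n : ℝ) * c * h / (1 - h)⌉₊ F : ℝ) with hγ
  have hγ0 : 0 ≤ γ := Nat.cast_nonneg _
  set D : ℝ := (d : ℝ) / (n * h) with hD
  set S : ℝ := 1 / c * ((1 - h) * γ / n) with hS
  have hD0 : 0 ≤ D := by positivity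
  rcases le_or_gt S (5 * D) with hSD | hSD
  · obtain ⟨P, hP, hbound⟩ :=
      LocalEntropy.exists_lower_bound_vcDim hFm hF hd hn hdn h1 hpc ν A
    refine ⟨P, hP, fun fstar hstar => ⟨(hbound fstar hstar).1, ?_⟩⟩
    refine le_trans ?_ (hbound fstar hstar).2
    linarith
  · have hlt : h < 1 := by
      refine lt_of_le_of_ne h1 fun he => ?_
      have : S = 0 := by simp [hS, he]
      linarith
    have hSγ : S ≤ γ / n := by
      have h2 : 1 / c ≤ 1 := (div_le_one (by linarith)).2 hc
      have h3 : (1 - h) * γ / n ≤ γ / n := by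
        gcongr
        nlinarith
      exact (mul_le_of_le_one_left (by have := sub_nonneg.2 h1; positivity) h2).trans h3
    -- A dominant entropy term makes `h γ` large: `5 / (n h) ≤ 5 D < S ≤ γ / n`.
    have hbig : 5 < h * γ := by
      have h2 : 5 * (1 / (n * h)) < γ / n := by
        have : 1 / (n * h) ≤ D := by rw [hD]; gcongr
        linarith
      rw [mul_one_div, div_lt_div_iff₀ (by positivity) hn0] at h2
      nlinarith
    have hnh : 1 ≤ n * h := by
      have h2 := (Real.sqrt_le_left h0.le).1 hdn
      rw [div_le_iff₀ hn0] at h2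
      nlinarith
    obtain ⟨P, hP, hbound⟩ :=
      LocalEntropy.exists_lower_bound_gammaLoc hFm h0 hlt hnh hpc rfl hbig ν A
    refine ⟨P, hP, fun fstar hstar => ⟨(hbound fstar hstar).1, ?_⟩⟩
    refine le_trans ?_ (hbound fstar hstar).2
    change _ ≤ 1 / 256 * S
    linarith
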